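/- Let $p,q$ be positive integers with $2 \le p/q < 4$. A $(p,q)$-colouring of a finite simple graph $G$ is a map $f : V(G) \to \{0,\dots,p-1\}$ such that $q \le |f(u)-f(v)| \le p-q$ for every edge $uv$ of $G$. For $(p,q)$-colourings $f,g$ of $G$, a reconfiguration sequence of length $n$ from $f$ to $g$ is a sequence $f=f_0,f_1,\dots,f_n=g$ of $(p,q)$-colourings of $G$ in which $f_i$ and $f_{i+1}$ differ on exactly one vertex for each $0 \le i < n$; $f$ reconfigures to $g$ if such a sequence exists for some $n \ge 0$. Then there is a constant $C$, depending only on $p$ and $q$, such that for every finite simple graph $G$ and all $(p,q)$-colourings $f,g$ of $G$: if $f$ reconfigures to $g$, then there is a reconfiguration sequence from $f$ to $g$ of length at most $C\,|V(G)|^2$. -/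

import Mathlib

/-- `f : V → {0, …, p - 1}` is a (circular) `(p, q)`-colouring of `G`:
`q ≤ |f u - f v| ≤ p - q` for every edge `uv`, computed in `ℤ`. -/
def IsCircularColouring {V : Type*} (G : SimpleGraph V) (p q : ℕ) (f : V → Fin p) : Prop :=
  ∀ u v : V, G.Adj u v →
    (q : ℤ) ≤ |((f u : ℕ) : ℤ) - ((f v : ℕ) : ℤ)| ∧
      |((f u : ℕ) : ℤ) - ((f v : ℕ) : ℤ)| ≤ (p : ℤ) - (q : ℤ)

/-- `s 0, s 1, …, s n` is a reconfiguration sequence of length `n` (that is, with `n`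
recolouring steps) from `f` to `g`: every term is a `(p, q)`-colouring of `G`, and consecutive
terms differ on exactly one vertex. -/
structure IsReconfigurationSequence {V : Type*} (G : SimpleGraph V) (p q : ℕ)
    (f g : V → Fin p) (n : ℕ) (s : Fin (n + 1) → V → Fin p) : Prop where
  start_eq : s 0 = f
  end_eq : s (Fin.last n) = g
  colouring : ∀ i : Fin (n + 1), IsCircularColouring G p q (s i)
  step : ∀ i : Fin n, ∃! v : V, s i.castSucc v ≠ s i.succ v

/-- `f` reconfigures to `g`: there is a reconfiguration sequence, of some length, from `f`
to `g`. -/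
def Reconfigures {V : Type*} (G : SimpleGraph V) (p q : ℕ) (f g : V → Fin p) : Prop :=
  ∃ (n : ℕ) (s : Fin (n + 1) → V → Fin p), IsReconfigurationSequence G p q f g n s

/-! ### Systems of difference constraints on a graph -/

namespace SimpleGraph

/-! Record a colouring by an integer displacement from `f`. Displacements keeping each edge in its
window of colour differences satisfy a system of difference constraints. Since `p < 4 * q`, a single
recolouring, taken the short way round the circle, cannot jump between windows, so reconfiguration
sequences lift (`exists_lift_step`).

In such a system a reachable point `d` can be approached by unit steps without detours: the only
obstruction is a set of vertices locked by tight constraints, and such a set could never have moved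
towards `d`. The length is thus the ℓ¹ norm of `d`. Subtracting multiples of `p` on whole components
keeps the target colouring, and truncation keeps reachability, so `d` may be taken with entries
linear in the number of vertices. Summing over vertices gives the quadratic bound. -/

/-- `d` satisfies the difference constraints `d v - d u ≤ c u v` along the edges of `G`. -/
def DiffFeasible {V : Type*} (G : SimpleGraph V) (c : V → V → ℤ) (d : V → ℤ) : Prop :=
  ∀ u v, G.Adj u v → d v - d u ≤ c u v

/-- Two feasible points that differ on at most one vertex. -/
def DiffStep {V : Type*} (G : SimpleGraph V) (c : V → V → ℤ) (x y : V → ℤ) : Prop :=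
  G.DiffFeasible c x ∧ G.DiffFeasible c y ∧ ∃ v, ∀ w, w ≠ v → x w = y w

section

variable {V : Type*} {G : SimpleGraph V} {c : V → V → ℤ} {x y d : V → ℤ}

theorem DiffStep.symm (h : G.DiffStep c x y) : G.DiffStep c y x := by
  obtain ⟨hx, hy, v, hv⟩ := h
  exact ⟨hy, hx, v, fun w hw => (hv w hw).symm⟩

theorem DiffFeasible.neg (h : G.DiffFeasible c x) :
    G.DiffFeasible (fun u v => c v u) (fun v => -x v) := by
  intro u v huv
  have := h v u huv.symm
  linarith

theorem DiffStep.neg (h : G.DiffStep c x y) :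
    G.DiffStep (fun u v => c v u) (fun v => -x v) (fun v => -y v) := by
  obtain ⟨hx, hy, v, hv⟩ := h
  exact ⟨hx.neg, hy.neg, v, fun w hw => congrArg Neg.neg (hv w hw)⟩

theorem reflTransGen_diffStep_symm (h : Relation.ReflTransGen (G.DiffStep c) x y) :
    Relation.ReflTransGen (G.DiffStep c) y x := by
  induction h with
  | refl => exact .refl
  | tail _ h ih => exact ih.head h.symm

theorem reflTransGen_diffStep_neg (h : Relation.ReflTransGen (G.DiffStep c) x y) :
    Relation.ReflTransGen (G.DiffStep fun u v => c v u) (fun v => -x v) (fun v => -y v) :=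
  Relation.ReflTransGen.lift (fun (z : V → ℤ) v => -z v) (fun _ _ h => DiffStep.neg h) _ _ h

theorem diffFeasible_of_reflTransGen (hx : G.DiffFeasible c x)
    (h : Relation.ReflTransGen (G.DiffStep c) x y) : G.DiffFeasible c y := by
  cases h with
  | refl => exact hx
  | tail _ h => exact h.2.1

/-- A set of vertices each of which has a tight constraint from inside the set cannot move up. -/
theorem le_of_tight {S : Set V}
    (hS : ∀ v ∈ S, ∃ u ∈ S, G.Adj u v ∧ x v - x u = c u v)
    (h : Relation.ReflTransGen (G.DiffStep c) x y) : ∀ v ∈ S, y v ≤ x v := by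
  induction h with
  | refl => exact fun _ _ => le_rfl
  | @tail y z _ hyz ih =>
    intro v hv
    obtain ⟨_, hz, w, hw⟩ := hyz
    by_cases hvw : v = w
    -- The tight neighbour `u` stays put while `v` moves and is not above `x u`, so its constraint
    -- caps `v` at `x v`.
    · obtain ⟨u, hu, huv, ht⟩ := hS v hv
      have h1 := hw u (fun h => huv.ne (h.trans hvw.symm))
      have h2 := hz u v huv
      have h3 := ih u hu
      linarith
    · rw [← hw v hvw]
      exact ih v hv

open Classical in
/-- If `d` is reachable from `x` and exceeds it somewhere, then some coordinate of `x` can be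
increased by one towards `d`. -/
theorem exists_feasible_increment [Finite V] (hx : G.DiffFeasible c x)
    (h : Relation.ReflTransGen (G.DiffStep c) x d) (hlt : ∃ v, x v < d v) :
    ∃ v, x v < d v ∧ G.DiffFeasible c (Function.update x v (x v + 1)) := by
  obtain ⟨v₀, hv₀⟩ := hlt
  have : Nonempty V := ⟨v₀⟩
  obtain ⟨m, hm⟩ := Finite.exists_max (fun v => d v - x v)
  have hm0 : x m < d m := by have := hm v₀; linarith
  by_contra! hcon
  -- If no increment is feasible, the set where `d - x` is maximal is locked: a constraint broken by
  -- raising `v` was tight at `x`, and as `d` satisfies it too, its source is also a maximiser.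
  have key : ∀ v ∈ {v | d v - x v = d m - x m},
      ∃ u ∈ {v | d v - x v = d m - x m}, G.Adj u v ∧ x v - x u = c u v := by
    intro v hv
    simp only [Set.mem_ofPred_eq] at hv ⊢
    have hnf := hcon v (by linarith)
    unfold DiffFeasible at hnf
    push Not at hnf
    obtain ⟨a, b, hab, hlt⟩ := hnf
    have hxab := hx a b hab
    have hdab := diffFeasible_of_reflTransGen hx h a b hab
    by_cases hb : b = v
    · subst hb
      have hav : a ≠ b := hab.ne
      rw [Function.update_self, Function.update_of_ne hav] at hlt
      have hma := hm a
      exact ⟨a, by omega, hab, by omega⟩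
    · rw [Function.update_of_ne hb] at hlt
      by_cases ha : a = v
      · subst ha
        rw [Function.update_self] at hlt
        omega
      · rw [Function.update_of_ne ha] at hlt
        omega
  have := le_of_tight key h m rfl
  omega

open Classical in
/-- If `d` is reachable from `x` and lies below it somewhere, then some coordinate of `x` can be
decreased by one towards `d`. -/
theorem exists_feasible_decrement [Finite V] (hx : G.DiffFeasible c x)
    (h : Relation.ReflTransGen (G.DiffStep c) x d) (hlt : ∃ v, d v < x v) :
    ∃ v, d v < x v ∧ G.DiffFeasible c (Function.update x v (x v - 1)) := by
  obtain ⟨v, hv, hf⟩ := exists_feasible_increment hx.neg (reflTransGen_diffStep_neg h)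
    (hlt.imp fun v hv => neg_lt_neg hv)
  refine ⟨v, neg_lt_neg_iff.mp hv, ?_⟩
  convert hf.neg using 1
  ext w
  by_cases hw : w = v
  · subst hw
    simp only [Function.update_self]
    ring
  · simp [Function.update_of_ne hw]

open Classical in
theorem exists_feasible_unit_step [Finite V] (hx : G.DiffFeasible c x)
    (h : Relation.ReflTransGen (G.DiffStep c) x d) (hne : x ≠ d) :
    ∃ v a, G.DiffFeasible c (Function.update x v a) ∧ |a - x v| = 1 ∧
      |d v - x v| = |d v - a| + 1 := by
  obtain ⟨v, hv⟩ := Function.ne_iff.mp hne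
  rcases lt_or_gt_of_ne hv with hv | hv
  · obtain ⟨w, hw, hf⟩ := exists_feasible_increment hx h ⟨v, hv⟩
    refine ⟨w, _, hf, by simp, ?_⟩
    rw [abs_of_pos (by omega), abs_of_nonneg (by omega)]
    ring
  · obtain ⟨w, hw, hf⟩ := exists_feasible_decrement hx h ⟨v, hv⟩
    refine ⟨w, _, hf, by simp, ?_⟩
    rw [abs_of_neg (by omega), abs_of_nonpos (by omega)]
    ring

/-! ### Truncation and bounded representatives -/

open Classical in
/-- A reachable point that is at least `k` on a union `S` of components can be lowered by `k`
on `S`. -/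
theorem reflTransGen_lower {S : Set V} (hS : ∀ u v, G.Adj u v → (u ∈ S ↔ v ∈ S)) {k : ℤ}
    (h0 : G.DiffFeasible c 0) (h : Relation.ReflTransGen (G.DiffStep c) 0 d)
    (hk : 0 ≤ k) (hd : ∀ v ∈ S, k ≤ d v) :
    Relation.ReflTransGen (G.DiffStep c) 0 (fun v => if v ∈ S then d v - k else d v) := by
  have hdf := diffFeasible_of_reflTransGen h0 h
  -- Capping at `d - k` on `S` preserves feasibility and single-vertex moves, fixes `0` because `k ≤
  -- d` on `S`, and sends `d` to the lowered point; so it carries the whole path along.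
  let T : (V → ℤ) → V → ℤ := fun y v => if v ∈ S then min (y v) (d v - k) else y v
  have hT : ∀ y, G.DiffFeasible c y → G.DiffFeasible c (T y) := by
    intro y hy u v huv
    have h1 := hy u v huv
    have h2 := hdf u v huv
    have h3 := hS u v huv
    by_cases hv : v ∈ S
    · simp only [T, h3.mpr hv, hv, if_true]
      omega
    · have hu : u ∉ S := fun h => hv (h3.mp h)
      simp only [T, hv, hu, if_false]
      exact h1
  have hl : Relation.ReflTransGen (G.DiffStep c) (T 0) (T d) := by
    refine Relation.ReflTransGen.lift T ?_ _ _ h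
    rintro a b ⟨ha, hb, v, hv⟩
    exact ⟨hT a ha, hT b hb, v, fun w hw => by simp only [T, hv w hw]⟩
  have e0 : T 0 = 0 := by
    ext v
    by_cases hv : v ∈ S
    · have := hd v hv
      simp only [T, hv, if_true, Pi.zero_apply]
      omega
    · simp [T, hv]
  have e1 : T d = fun v => if v ∈ S then d v - k else d v := by
    ext v
    by_cases hv : v ∈ S
    · simp only [T, hv, if_true]
      omega
    · simp [T, hv]
  rwa [e0, e1] at hl

/-- A function that changes by at most `B` along edges changes by at most `B` times the number of
vertices on each component. -/
theorem abs_sub_le_of_reachable [Fintype V] {B : ℤ} (hB : 0 ≤ B)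
    (hd : ∀ u v, G.Adj u v → |d v - d u| ≤ B) {u v : V} (h : G.Reachable u v) :
    |d v - d u| ≤ B * Fintype.card V := by
  have key : ∀ {u v : V} (w : G.Walk u v), |d v - d u| ≤ B * w.length := by
    intro u v w
    induction w with
    | nil => simp
    | @cons a b e hab w ih =>
      have h1 := hd a b hab
      have h2 := abs_sub_le (d e) (d b) (d a)
      rw [Walk.length_cons]
      push_cast
      linarith
  obtain ⟨w, hw⟩ := h.exists_isPath
  refine (key w).trans (mul_le_mul_of_nonneg_left ?_ hB)
  exact_mod_cast hw.length_lt.le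

open Classical in
/-- A reachable point that is large somewhere has a smaller reachable point congruent to it. -/
theorem exists_reachable_smaller_of_large [Fintype V] {p B : ℤ} (hp : 0 < p) (hB : 0 ≤ B)
    (h0 : G.DiffFeasible c 0) (h : Relation.ReflTransGen (G.DiffStep c) 0 d)
    (hd : ∀ u v, G.Adj u v → |d v - d u| ≤ B) {v : V} (hv : p + B * Fintype.card V ≤ d v) :
    ∃ d' : V → ℤ, Relation.ReflTransGen (G.DiffStep c) 0 d' ∧ (∀ w, d' w ≡ d w [ZMOD p]) ∧
      ∑ w, (d' w).natAbs < ∑ w, (d w).natAbs := by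
  have hlow : ∀ w ∈ {w | G.Reachable v w}, p ≤ d w := by
    intro w hw
    have h1 := abs_le.mp (abs_sub_le_of_reachable hB hd hw)
    linarith [h1.1]
  refine ⟨_, reflTransGen_lower (S := {w | G.Reachable v w}) (k := p) ?_ h0 h hp.le hlow,
    ?_, ?_⟩
  · intro a b hab
    exact ⟨fun ha => ha.trans hab.reachable, fun hb => hb.trans hab.symm.reachable⟩
  · intro w
    split_ifs
    · exact Int.modEq_iff_dvd.mpr ⟨1, by ring⟩
    · rfl
  · refine Finset.sum_lt_sum (fun w _ => ?_) ⟨v, Finset.mem_univ v, ?_⟩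
    · split_ifs with hw
      · have := hlow w hw
        omega
      · rfl
    · have := hlow v (Reachable.refl v)
      rw [if_pos (show v ∈ {w | G.Reachable v w} from Reachable.refl v)]
      omega

/-- Among the reachable points congruent to a given one modulo `p`, some have all coordinates
linearly bounded in the number of vertices. -/
theorem exists_reachable_bounded [Fintype V] {p B : ℤ} (hp : 0 < p) (hB : 0 ≤ B)
    (h0 : G.DiffFeasible c 0)
    (hc : ∀ y, G.DiffFeasible c y → ∀ u v, G.Adj u v → |y v - y u| ≤ B)
    (h : Relation.ReflTransGen (G.DiffStep c) 0 d) :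
    ∃ d' : V → ℤ, Relation.ReflTransGen (G.DiffStep c) 0 d' ∧ (∀ w, d' w ≡ d w [ZMOD p]) ∧
      ∀ v, |d' v| ≤ p + B * Fintype.card V := by
  induction hN : ∑ w, (d w).natAbs using Nat.strong_induction_on generalizing d with
  | _ N ih =>
    by_cases hb : ∀ v, |d v| ≤ p + B * Fintype.card V
    · exact ⟨d, h, fun _ => rfl, hb⟩
    suffices ∃ d' : V → ℤ, Relation.ReflTransGen (G.DiffStep c) 0 d' ∧
        (∀ w, d' w ≡ d w [ZMOD p]) ∧ ∑ w, (d' w).natAbs < ∑ w, (d w).natAbs by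
      obtain ⟨d', h', hcong, hlt⟩ := this
      obtain ⟨e, he, hce, hbe⟩ := ih _ (hN ▸ hlt) h' rfl
      exact ⟨e, he, fun w => (hce w).trans (hcong w), hbe⟩
    push Not at hb
    obtain ⟨v, hv⟩ := hb
    have hd := hc d (diffFeasible_of_reflTransGen h0 h)
    rcases lt_abs.mp hv with hv | hv
    · exact exists_reachable_smaller_of_large hp hB h0 h hd hv.le
    -- Very negative entries reduce to the previous case by negation, which reverses the
    -- constraints.
    · have h' := reflTransGen_diffStep_neg h
      have e0 : (fun v => -(0 : V → ℤ) v) = (0 : V → ℤ) := by ext; simp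
      have h0' := h0.neg
      rw [e0] at h' h0'
      obtain ⟨e, he, hce, hlt⟩ := exists_reachable_smaller_of_large hp hB h0' h'
        (fun a b hab => by rw [neg_sub_neg, abs_sub_comm]; exact hd a b hab) hv.le
      have he' := reflTransGen_diffStep_neg he
      rw [e0] at he'
      refine ⟨fun w => -e w, he', fun w => ?_, by simpa using hlt⟩
      simpa using (hce w).neg

end

end SimpleGraph

/-! ### Circular colourings and their displacements -/

/-- The condition on the two ends of an edge in a circular colouring, modulo `p`. -/
theorem abs_sub_mem_iff_exists_shift {p q a b : ℤ} (hq : 0 < q) (ha : 0 ≤ a) (hap : a < p)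
    (hb : 0 ≤ b) (hbp : b < p) :
    (q ≤ |a - b| ∧ |a - b| ≤ p - q) ↔ ∃ k : ℤ, q ≤ b - a + k * p ∧ b - a + k * p ≤ p - q := by
  constructor
  · rintro ⟨h1, h2⟩
    rcases le_total a b with h | h
    · rw [abs_of_nonpos (by omega)] at h1 h2
      exact ⟨0, by omega, by omega⟩
    · rw [abs_of_nonneg (by omega)] at h1 h2
      exact ⟨1, by omega, by omega⟩
  · rintro ⟨k, h1, h2⟩
    have hk0 : 0 ≤ k := by
      by_contra! h
      nlinarith
    have hk1 : k ≤ 1 := by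
      by_contra! h
      nlinarith
    interval_cases k
    · rw [abs_of_nonpos (by omega)]
      omega
    · rw [abs_of_nonneg (by omega)]
      omega

section

variable {V : Type*} {G : SimpleGraph V} {p q : ℕ} {f : V → Fin p}

theorem isCircularColouring_iff (hq : 0 < q) :
    IsCircularColouring G p q f ↔ ∀ u v, G.Adj u v →
      ∃ k : ℤ, (q : ℤ) ≤ (f v : ℕ) - (f u : ℕ) + k * p ∧
        ((f v : ℕ) : ℤ) - (f u : ℕ) + k * p ≤ p - q := by
  refine forall₃_congr fun u v _ => abs_sub_mem_iff_exists_shift ?_ ?_ ?_ ?_ ?_ <;> omega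

/-- The slack of the colouring `f` on the arc from `u` to `v`: how far `f v` can be increased
before it gets too close to `f u` from below. -/
def circularSlack (q : ℕ) (f : V → Fin p) (u v : V) : ℤ :=
  p - q - (((f v : ℕ) : ℤ) - (f u : ℕ)) % p

theorem IsCircularColouring.emod_bounds (hq : 0 < q) (hf : IsCircularColouring G p q f) {u v : V}
    (huv : G.Adj u v) :
    (q : ℤ) ≤ (((f v : ℕ) : ℤ) - (f u : ℕ)) % p ∧
      (((f v : ℕ) : ℤ) - (f u : ℕ)) % p ≤ p - q := by
  obtain ⟨k, h1, h2⟩ := (isCircularColouring_iff hq).mp hf u v huv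
  have : (((f v : ℕ) : ℤ) - (f u : ℕ)) % p = (f v : ℕ) - (f u : ℕ) + k * p := by
    rw [← Int.add_mul_emod_self_right _ k, Int.emod_eq_of_lt] <;> omega
  rw [this]
  exact ⟨h1, h2⟩

/-- The two residues along an edge are nonzero and sum to `p`. Hence the upper constraints on both
orientations encode the two-sided window. -/
theorem circularSlack_add_swap (hq : 0 < q) (hf : IsCircularColouring G p q f) {u v : V}
    (huv : G.Adj u v) : circularSlack q f u v + circularSlack q f v u = p - 2 * q := by
  obtain ⟨h1, h2⟩ := hf.emod_bounds hq huv
  have : (((f u : ℕ) : ℤ) - (f v : ℕ)) % p = p - (((f v : ℕ) : ℤ) - (f u : ℕ)) % p := by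
    have e : ((f u : ℕ) : ℤ) - (f v : ℕ) = p - (((f v : ℕ) : ℤ) - (f u : ℕ)) % p +
        p * (-1 - (((f v : ℕ) : ℤ) - (f u : ℕ)) / p) := by
      linarith [Int.emod_add_mul_ediv (((f v : ℕ) : ℤ) - (f u : ℕ)) p]
    conv_lhs => rw [e]
    rw [Int.add_mul_emod_self_left, Int.emod_eq_of_lt] <;> omega
  unfold circularSlack
  rw [this]
  ring

theorem diffFeasible_circularSlack_zero (hq : 0 < q) (hf : IsCircularColouring G p q f) :
    G.DiffFeasible (circularSlack q f) 0 := by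
  intro u v huv
  have := (hf.emod_bounds hq huv).2
  simp only [Pi.zero_apply, circularSlack]
  omega

/-- Feasible displacements keep the colour difference along an edge in the allowed window. -/
theorem feasible_window (hq : 0 < q) (hf : IsCircularColouring G p q f) {d : V → ℤ}
    (hd : G.DiffFeasible (circularSlack q f) d) {u v : V} (huv : G.Adj u v) :
    (q : ℤ) ≤ (((f v : ℕ) : ℤ) - (f u : ℕ)) % p + d v - d u ∧
      (((f v : ℕ) : ℤ) - (f u : ℕ)) % p + d v - d u ≤ p - q := by
  have h1 := hd u v huv
  have h2 := hd v u huv.symm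
  have h3 := circularSlack_add_swap hq hf huv
  have h4 : circularSlack q f u v = p - q - (((f v : ℕ) : ℤ) - (f u : ℕ)) % p := rfl
  constructor <;> linarith

/-- Feasibility only has to be checked on one window per arc. -/
theorem diffFeasible_of_window {d : V → ℤ}
    (h : ∀ u v, G.Adj u v → (((f v : ℕ) : ℤ) - (f u : ℕ)) % p + d v - d u ≤ p - q) :
    G.DiffFeasible (circularSlack q f) d := by
  intro u v huv
  have := h u v huv
  unfold circularSlack
  linarith

theorem abs_sub_le_of_diffFeasible (hq : 0 < q) (hf : IsCircularColouring G p q f) {d : V → ℤ}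
    (hd : G.DiffFeasible (circularSlack q f) d) {u v : V} (huv : G.Adj u v) :
    |d v - d u| ≤ p := by
  have h1 := feasible_window hq hf hd huv
  have h2 := hf.emod_bounds hq huv
  rw [abs_le]
  constructor <;> omega

/-- Move every colour of `f` by `d` around the circle. -/
def displace (hp : 0 < p) (f : V → Fin p) (d : V → ℤ) (v : V) : Fin p :=
  ⟨((((f v : ℕ) : ℤ) + d v) % p).toNat, by
    have h1 := Int.emod_nonneg (((f v : ℕ) : ℤ) + d v) (by omega : (p : ℤ) ≠ 0)
    have h2 := Int.emod_lt_of_pos (((f v : ℕ) : ℤ) + d v) (by omega : (0 : ℤ) < p)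
    omega⟩

theorem coe_displace (hp : 0 < p) (d : V → ℤ) (v : V) :
    ((displace hp f d v : ℕ) : ℤ) = (((f v : ℕ) : ℤ) + d v) % p :=
  Int.toNat_of_nonneg (Int.emod_nonneg _ (by omega))

theorem displace_eq_of_modEq (hp : 0 < p) {g : V → Fin p} {d : V → ℤ}
    (h : ∀ v, ((g v : ℕ) : ℤ) ≡ (f v : ℕ) + d v [ZMOD p]) : displace hp f d = g := by
  funext v
  apply Fin.ext
  have h1 := coe_displace (f := f) hp d v
  rw [← (h v).eq, Int.emod_eq_of_lt (by omega) (by omega)] at h1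
  exact_mod_cast h1

theorem isCircularColouring_displace (hq : 0 < q) (hp : 0 < p) (hf : IsCircularColouring G p q f)
    {d : V → ℤ} (hd : G.DiffFeasible (circularSlack q f) d) :
    IsCircularColouring G p q (displace hp f d) := by
  rw [isCircularColouring_iff hq]
  intro u v huv
  have h := feasible_window hq hf hd huv
  rw [coe_displace, coe_displace]
  refine ⟨(((f v : ℕ) : ℤ) + d v) / p - (((f u : ℕ) : ℤ) + d u) / p
    - (((f v : ℕ) : ℤ) - (f u : ℕ)) / p, ?_⟩
  have e1 := Int.emod_add_mul_ediv (((f v : ℕ) : ℤ) + d v) p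
  have e2 := Int.emod_add_mul_ediv (((f u : ℕ) : ℤ) + d u) p
  have e3 := Int.emod_add_mul_ediv (((f v : ℕ) : ℤ) - (f u : ℕ)) p
  constructor <;> linarith [h.1, h.2]

/-! ### Lifting recolourings -/

open Classical in
/-- A recolouring of one vertex lifts to a move of displacements; this is where `p < 4 q`
is needed. -/
theorem exists_lift_step (hq : 0 < q) (h4 : p < 4 * q) (hf : IsCircularColouring G p q f)
    {g g' : V → Fin p} {d : V → ℤ} (hd : G.DiffFeasible (circularSlack q f) d)
    (hg : ∀ v, ((g v : ℕ) : ℤ) ≡ (f v : ℕ) + d v [ZMOD p])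
    (hg' : IsCircularColouring G p q g') {v : V} (hv : ∀ w, w ≠ v → g w = g' w) :
    ∃ d', G.DiffStep (circularSlack q f) d d' ∧
      ∀ w, ((g' w : ℕ) : ℤ) ≡ (f w : ℕ) + d' w [ZMOD p] := by
  have hp : 0 < p := (Nat.zero_le _).trans_lt (g v).isLt
  -- The short way round the circle, so `2 * |e| ≤ p`.
  set e : ℤ := (((g' v : ℕ) : ℤ) - (g v : ℕ)).bmod p with he
  have he1 : (-(p : ℤ) ≤ 2 * e) := by
    have := Int.le_bmod (x := ((g' v : ℕ) : ℤ) - (g v : ℕ)) hp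
    omega
  have he2 : 2 * e ≤ p := by
    have := Int.bmod_lt (x := ((g' v : ℕ) : ℤ) - (g v : ℕ)) hp
    omega
  have hcong : ∀ w, ((g' w : ℕ) : ℤ) ≡ (f w : ℕ) + Function.update d v (d v + e) w [ZMOD p] := by
    intro w
    by_cases hw : w = v
    · subst hw
      rw [Function.update_self]
      have h1 : e ≡ ((g' w : ℕ) : ℤ) - (g w : ℕ) [ZMOD p] := Int.bmod_emod
      have h2 := (hg w).add h1.symm
      rwa [add_sub_cancel, add_assoc] at h2
    · rw [Function.update_of_ne hw, ← hv w hw]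
      exact hg w
  refine ⟨Function.update d v (d v + e), ⟨hd, ?_, v, fun w hw => ?_⟩, hcong⟩
  · apply diffFeasible_of_window
    intro a b hab
    obtain ⟨k, hk1, hk2⟩ := (isCircularColouring_iff hq).mp hg' a b hab
    have hw := feasible_window hq hf hd hab
    obtain ⟨s, hs⟩ := (hcong a).dvd
    obtain ⟨t, ht⟩ := (hcong b).dvd
    have e3 := Int.emod_add_mul_ediv (((f b : ℕ) : ℤ) - (f a : ℕ)) p
    obtain ⟨m, hm⟩ : ∃ m : ℤ, (((f b : ℕ) : ℤ) - (f a : ℕ)) % p +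
        Function.update d v (d v + e) b - Function.update d v (d v + e) a =
        ((g' b : ℕ) : ℤ) - (g' a : ℕ) + k * p + m * p :=
      ⟨t - s - k - (((f b : ℕ) : ℤ) - (f a : ℕ)) / p, by linarith⟩
    have hbd : |Function.update d v (d v + e) b - Function.update d v (d v + e) a
        - (d b - d a)| ≤ |e| := by
      by_cases hb : b = v
      · subst hb
        rw [Function.update_self, Function.update_of_ne hab.ne]
        exact le_of_eq (by congr 1; ring)
      · by_cases ha : a = v
        · subst ha
          rw [Function.update_self, Function.update_of_ne hb, ← abs_neg e]
          exact le_of_eq (by congr 1; ring)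
        · rw [Function.update_of_ne hb, Function.update_of_ne ha]
          simp
    have hbe : |e| * 2 ≤ p := by
      rcases abs_cases e with h | h <;> omega
    have hbd' := abs_le.mp hbd
    -- `|m * p|` is at most the window width `p - 2 * q` plus `|e| ≤ p / 2`, which is below `p`
    -- exactly because `p < 4 * q`.
    have hm0 : m = 0 := by
      have h1 : m * p < 1 * p := by omega
      have h2 : (-1) * (p : ℤ) < m * p := by omega
      have hp' : (0 : ℤ) < p := by omega
      have h3 := lt_of_mul_lt_mul_right h1 hp'.le
      have h5 := lt_of_mul_lt_mul_right h2 hp'.le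
      omega
    rw [hm, hm0]
    linarith
  · rw [Function.update_of_ne hw]

/-- A reconfiguration sequence lifts to a sequence of moves of displacements. -/
theorem Reconfigures.exists_lift (hq : 0 < q) (h4 : p < 4 * q) {g : V → Fin p}
    (h : Reconfigures G p q f g) :
    ∃ d, Relation.ReflTransGen (G.DiffStep (circularSlack q f)) 0 d ∧
      ∀ w, ((g w : ℕ) : ℤ) ≡ (f w : ℕ) + d w [ZMOD p] := by
  obtain ⟨n, s, hs⟩ := h
  have hf : IsCircularColouring G p q f := hs.start_eq ▸ hs.colouring 0
  have h0 := diffFeasible_circularSlack_zero hq hf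
  rw [← hs.end_eq]
  induction Fin.last n using Fin.induction with
  | zero => exact ⟨0, .refl, fun w => by simp [hs.start_eq]⟩
  | succ i ih =>
    obtain ⟨d, hd, hc⟩ := ih
    obtain ⟨v, -, huniq⟩ := hs.step i
    obtain ⟨d', hd', hc'⟩ := exists_lift_step hq h4 hf
      (SimpleGraph.diffFeasible_of_reflTransGen h0 hd) hc (hs.colouring i.succ) (v := v)
      (fun w hw => by_contra fun hne => hw (huniq w hne))
    exact ⟨d', hd.tail hd', hc'⟩

/-! ### Realising displacements by unit steps -/

theorem IsReconfigurationSequence.cons {a b g : V → Fin p} {n : ℕ} {s : Fin (n + 1) → V → Fin p}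
    (ha : IsCircularColouring G p q a) (hab : ∃! v, a v ≠ b v)
    (hs : IsReconfigurationSequence G p q b g n s) :
    IsReconfigurationSequence G p q a g (n + 1) (Fin.cons a s : Fin (n + 2) → V → Fin p) where
  start_eq := rfl
  end_eq := by rw [← Fin.succ_last, Fin.cons_succ, hs.end_eq]
  colouring := Fin.cases ha hs.colouring
  step := by
    refine Fin.cases ?_ fun i => ?_
    · rw [Fin.cons_succ, hs.start_eq]
      exact hab
    · rw [Fin.cons_succ, ← Fin.succ_castSucc, Fin.cons_succ]
      exact hs.step i

open Classical in
theorem existsUnique_displace_ne (hp : 1 < p) (x : V → ℤ) {v : V} {a : ℤ} (ha : |a - x v| = 1) :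
    ∃! w, displace (by omega) f x w ≠ displace (by omega) f (Function.update x v a) w := by
  refine ⟨v, fun h => ?_, fun w hw => by_contra fun hne => hw ?_⟩
  · have h1 := congrArg (fun i : Fin p => ((i : ℕ) : ℤ)) h
    simp only [coe_displace, Function.update_self] at h1
    have h2 := Int.ModEq.dvd h1
    rw [add_sub_add_left_eq_sub, ← dvd_abs, ha] at h2
    have := Int.le_of_dvd one_pos h2
    omega
  · apply Fin.ext
    simp [displace, Function.update_of_ne hne]

/-- A reachable displacement is realised by unit steps without detours. -/
theorem exists_reconfigurationSequence_displace [Fintype V] (hq : 0 < q) (hp : 1 < p)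
    (hf : IsCircularColouring G p q f) {x d : V → ℤ}
    (hx : G.DiffFeasible (circularSlack q f) x)
    (h : Relation.ReflTransGen (G.DiffStep (circularSlack q f)) x d) (N : ℕ)
    (hN : ∑ v, |d v - x v| = N) :
    ∃ s, IsReconfigurationSequence G p q (displace (by omega) f x) (displace (by omega) f d)
      N s := by
  classical
  induction N generalizing x with
  | zero =>
    have hxd : d = x := by
      rw [Nat.cast_zero, Finset.sum_eq_zero_iff_of_nonneg fun _ _ => abs_nonneg _] at hN
      funext v
      exact sub_eq_zero.mp (abs_eq_zero.mp (hN v (Finset.mem_univ v)))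
    subst hxd
    exact ⟨fun _ => displace (by omega) f d, rfl, rfl,
      fun _ => isCircularColouring_displace hq _ hf hx, fun i => i.elim0⟩
  | succ N ih =>
    have hne : x ≠ d := by
      rintro rfl
      simp at hN
      omega
    obtain ⟨v, a, hfa, ha, hda⟩ := SimpleGraph.exists_feasible_unit_step hx h hne
    -- Moves are reversible, so `d` stays reachable from the new point by first stepping back to
    -- `x`.
    have hstep : G.DiffStep (circularSlack q f) (Function.update x v a) x :=
      ⟨hfa, hx, v, fun w hw => Function.update_of_ne hw _ _⟩
    obtain ⟨s, hs⟩ := ih hfa (h.head hstep) (by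
      rw [← Finset.add_sum_erase _ _ (Finset.mem_univ v)] at hN ⊢
      rw [Function.update_self]
      rw [Finset.sum_congr rfl fun w hw => by
        rw [Function.update_of_ne (Finset.ne_of_mem_erase hw)]]
      push_cast at hN
      linarith)
    exact ⟨_, hs.cons (isCircularColouring_displace hq _ hf hx)
      (existsUnique_displace_ne hp x ha)⟩

end

theorem mainTheorem4 (p q : ℕ) (hq : 0 < q)
    (h2 : (2 : ℚ) ≤ (p : ℚ) / (q : ℚ)) (h4 : (p : ℚ) / (q : ℚ) < 4) :
    ∃ C : ℕ, ∀ (V : Type*) [Fintype V] (G : SimpleGraph V) (f g : V → Fin p),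
      IsCircularColouring G p q f → IsCircularColouring G p q g →
      Reconfigures G p q f g →
      ∃ (n : ℕ) (s : Fin (n + 1) → V → Fin p),
        IsReconfigurationSequence G p q f g n s ∧ n ≤ C * Fintype.card V ^ 2 := by
  have hq' : (0 : ℚ) < q := by exact_mod_cast hq
  have h2' : 2 * q ≤ p := by
    rw [le_div_iff₀ hq'] at h2
    exact_mod_cast h2
  have h4' : p < 4 * q := by
    rw [div_lt_iff₀ hq'] at h4
    exact_mod_cast h4
  -- Each entry is at most `p + p * |V| ≤ 2 * p * |V|` when there is a vertex, and there are `|V|`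
  -- entries.
  refine ⟨2 * p, fun V _ G f g hf _ hfg => ?_⟩
  obtain ⟨d₀, hd₀, hg₀⟩ := hfg.exists_lift hq h4'
  have h0 := diffFeasible_circularSlack_zero hq hf
  obtain ⟨d, hd, hcong, hbd⟩ := SimpleGraph.exists_reachable_bounded (p := p) (B := p)
    (by omega) (by omega) h0 (fun y hy u v huv => abs_sub_le_of_diffFeasible hq hf hy huv) hd₀
  have hnonneg : 0 ≤ ∑ v, |d v - (0 : V → ℤ) v| := Finset.sum_nonneg fun _ _ => abs_nonneg _
  obtain ⟨N, hN⟩ := Int.eq_ofNat_of_zero_le hnonneg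
  obtain ⟨s, hs⟩ := exists_reconfigurationSequence_displace hq (by omega) hf h0 hd N hN
  have e1 : displace (by omega) f (0 : V → ℤ) = f :=
    displace_eq_of_modEq _ fun v => by simp
  have e2 : displace (by omega) f d = g :=
    displace_eq_of_modEq _ fun v => (hg₀ v).trans ((hcong v).symm.add_left _)
  rw [e1, e2] at hs
  refine ⟨N, s, hs, ?_⟩
  have hle : ∑ v, |d v - (0 : V → ℤ) v| ≤ ∑ _v : V, (2 * p * Fintype.card V : ℤ) := by
    refine Finset.sum_le_sum fun v _ => ?_
    have hcard : (1 : ℤ) ≤ Fintype.card V := by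
      exact_mod_cast Fintype.card_pos_iff.mpr ⟨v⟩
    have := hbd v
    rw [Pi.zero_apply, sub_zero]
    nlinarith [Int.natCast_nonneg p]
  rw [hN, Finset.sum_const, Finset.card_univ, nsmul_eq_mul] at hle
  zify
  calc (N : ℤ) ≤ _ := hle
    _ = _ := by ring
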